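/- Let $\mathcal{X}$ be a non-empty set, let $\mathcal{L}$ be the real vector space of all gambles (bounded real-valued maps) on $\mathcal{X}$, and identify each real number with the corresponding constant gamble. Let $\mathcal{Q}$ be the set of all finite subsets of $\mathcal{L}$, including $\emptyset$. For $V\subseteq\mathcal{L}$ let $\mathrm{posi}(V)$ be the set of all sums $\sum_{k=1}^n\lambda_k u_k$ with $n\ge 1$, $\lambda_k>0$ and $u_k\in V$; write $(\lambda,\mu)>0$ if $\lambda\ge0$, $\mu\ge0$ and $\lambda+\mu>0$; and write $A-v=\{u-v: u\in A\}$. A set $D\subseteq\mathcal{L}$ is *coherent* if $0\notin D$, if $D$ contains every gamble $u$ with $\inf u>0$, and if $\lambda u+\mu v\in D$ whenever $u,v\in D$ and $(\lambda,\mu)>0$. It is *mixing* if it is coherent and, for all $A\in\mathcal{Q}$, $\mathrm{posi}(A)\cap D\ne\emptyset$ implies $A\cap D\neq\emptyset$. It is *Archimedean* if it is coherent and for every $u\in D$ there is a real $\epsilon>0$ with $u-\epsilon\in D$. For Archimedean $D$ let $\underline{P}_D(u)=\sup\{\mu\in\mathbb{R}: u-\mu\in D\}$ for $u\in\mathcal{L}$.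 A set $\mathcal{D}$ of Archimedean sets $D$ is *closed* if it contains every Archimedean $D$ for which $\underline{P}_D$ lies in the closure of $\{\underline{P}_{D'}:D'\in\mathcal{D}\}$ in $\mathbb{R}^{\mathcal{L}}$ with the topology of pointwise convergence. Let $K_D=\{A\in\mathcal{Q}: A\cap D\ne\emptyset\}$. A set $K\subseteq\mathcal{Q}$ is *coherent* if, for all $A,A_1,A_2\in\mathcal{Q}$: $A\in K$ implies $A\setminus\{0\}\in K$; $\{0\}\notin K$; $\{u\}\in K$ for every gamble $u$ with $\inf u>0$; if $A_1,A_2\in K$ and $(\lambda_{u,v},\mu_{u,v})>0$ for all $u\in A_1$ and $v\in A_2$, then $\{\lambda_{u,v}u+\mu_{u,v}v: u\in A_1,\,v\in A_2\}\in K$; and $A_1\in K$ and $A_1\subseteq A_2$ imply $A_2\in K$. It is *mixing* if it is coherent and $B\in K$, $A\subseteq B\subseteq\mathrm{posi}(A)$ imply $A\in K$ for all $A,B\in\mathcal{Q}$. It is *Archimedean* if it is coherent and for every $A\in K$ there is a real $\epsilon>0$ with $A-\epsilon\in K$. A *linear prevision* is a map $P:\mathcal{L}\to\mathbb{R}$ with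 $P(u)\ge\inf u$, $P(\lambda u)=\lambda P(u)$ and $P(u+v)=P(u)+P(v)$ for all $u,v\in\mathcal{L}$ and real $\lambda>0$. For a set $\mathcal{M}$ of linear previsions, an option $u\in A$ is *E-admissible* in $A\in\mathcal{Q}$ if there is some $P\in\mathcal{M}$ with $P(u)\ge P(v)$ for all $v\in A$, and $R_{\mathcal{M}}(A)$ is the set of those $u\in A$ that are not E-admissible in $A$. **Theorem.** For every $K\subseteq\mathcal{Q}$ the following are equivalent: 1. $K$ is mixing and Archimedean; 2. there is a non-empty closed set $\mathcal{D}$ of mixing and Archimedean sets $D\subseteq\mathcal{L}$ such that $K=\bigcap_{D\in\mathcal{D}}K_D$; 3. there is a non-empty set $\mathcal{M}$ of linear previsions, closed in the topology of pointwise convergence on $\mathbb{R}^{\mathcal{L}}$, such that $K$ is the choice model of E-admissibility with respect to $\mathcal{M}$: for all $u\in\mathcal{L}$ and $A\in\mathcal{Q}$, $u\in R_{\mathcal{M}}(A\cup\{u\})$ if and only if $A-u\in K$. If these conditions hold, then the largest set $\mathcal{D}$ as in 2 is the set of all mixing and Archimedean $D\subseteq\mathcal{L}$ with $K\subseteq K_D$.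 -/

import Mathlib

noncomputable section

namespace Desirability

/-! Choice models on an abstract option space: a real vector space `V` with a set `pos` of
options that are positive in the background ordering. Option sets are finite subsets of `V`, the
empty set included. -/

section Abstract

variable {V : Type*} [AddCommGroup V] [Module ℝ V]

/-- `(a, b) > 0`: both are nonnegative and at least one of them is positive. -/
def PosPair (a b : ℝ) : Prop := 0 ≤ a ∧ 0 ≤ b ∧ 0 < a + b

/-- The set of all positive linear combinations (with at least one term) of elements of `S`. -/
def posi (S : Set V) : Set V :=
  {x | ∃ n : ℕ, 0 < n ∧ ∃ (c : Fin n → ℝ) (u : Fin n → V),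
    (∀ k, 0 < c k) ∧ (∀ k, u k ∈ S) ∧ x = ∑ k, c k • u k}

open Classical in
/-- The option set `A - v = {u - v : u ∈ A}`. -/
def shift (A : Finset V) (v : V) : Finset V := A.image fun u => u - v

open Classical in
/-- The option set `{lam u v • u + mu u v • v : u ∈ A₁, v ∈ A₂}`. -/
def combine (lam mu : V → V → ℝ) (A₁ A₂ : Finset V) : Finset V :=
  Finset.image₂ (fun u v => lam u v • u + mu u v • v) A₁ A₂

open Classical in
/-- Coherence of a set of desirable option sets. -/
structure IsCoherentSets (pos : Set V) (K : Set (Finset V)) : Prop where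
  erase_zero : ∀ A ∈ K, A.erase 0 ∈ K
  zero_notMem : ({0} : Finset V) ∉ K
  pos_mem : ∀ u ∈ pos, ({u} : Finset V) ∈ K
  cone : ∀ A₁ ∈ K, ∀ A₂ ∈ K, ∀ lam mu : V → V → ℝ,
    (∀ u ∈ A₁, ∀ v ∈ A₂, PosPair (lam u v) (mu u v)) → combine lam mu A₁ A₂ ∈ K
  mono : ∀ A₁ ∈ K, ∀ A₂ : Finset V, A₁ ⊆ A₂ → A₂ ∈ K

/-- Mixing sets of desirable option sets: coherent, and options that are positive linear
combinations of the remaining ones can be removed. -/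
structure IsMixingSets (pos : Set V) (K : Set (Finset V)) : Prop
    extends IsCoherentSets pos K where
  mixing : ∀ A B : Finset V, B ∈ K → A ⊆ B → (B : Set V) ⊆ posi (A : Set V) → A ∈ K

/-- Coherence of a set of desirable options. -/
structure IsCoherent (pos : Set V) (D : Set V) : Prop where
  zero_notMem : (0 : V) ∉ D
  pos_subset : pos ⊆ D
  cone : ∀ u ∈ D, ∀ v ∈ D, ∀ a b : ℝ, PosPair a b → a • u + b • v ∈ D

/-- Mixing sets of desirable options. -/
structure IsMixing (pos : Set V) (D : Set V) : Prop extends IsCoherent pos D where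
  mixing : ∀ A : Finset V, (posi (A : Set V) ∩ D).Nonempty → ((A : Set V) ∩ D).Nonempty

/-- The (binary) set of desirable option sets `K_D`: all option sets that meet `D`. -/
def setsOf (D : Set V) : Set (Finset V) := {A | ((A : Set V) ∩ D).Nonempty}

open Classical in
/-- The set of desirable option sets `K` and the rejection function `R` are connected:
`u ∈ R (A ∪ {u})` if and only if `A - u ∈ K`, for every option `u` and option set `A`. -/
def Connected (K : Set (Finset V)) (R : Finset V → Finset V) : Prop :=
  ∀ (u : V) (A : Finset V), u ∈ R (insert u A) ↔ shift A u ∈ K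

open Classical in
/-- The choice function of E-admissibility for a set `M` of expectation functionals: `u ∈ A` is
chosen from `A` when it maximises `P` over `A` for at least one `P ∈ M`. -/
def eAdmissible (M : Set (V → ℝ)) (A : Finset V) : Finset V :=
  A.filter fun u => ∃ P ∈ M, ∀ v ∈ A, P v ≤ P u

open Classical in
/-- The rejection function of E-admissibility. -/
def eRejected (M : Set (V → ℝ)) (A : Finset V) : Finset V := A \ eAdmissible M A

end Abstract

/-! Gambles on a set of states `X`. -/

section Gambles

variable (X : Type*)

/-- The vector space of gambles on `X`: the bounded real-valued maps on `X`, with pointwise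
operations. -/
def gambles : Submodule ℝ (X → ℝ) where
  carrier := {f | ∃ C : ℝ, ∀ x, |f x| ≤ C}
  zero_mem' := ⟨0, fun x => by simp⟩
  add_mem' := by
    rintro f g ⟨C, hC⟩ ⟨C', hC'⟩
    exact ⟨C + C', fun x => (abs_add_le _ _).trans (add_le_add (hC x) (hC' x))⟩
  smul_mem' := by
    rintro c f ⟨C, hC⟩
    refine ⟨|c| * C, fun x => ?_⟩
    simpa [abs_mul] using mul_le_mul_of_nonneg_left (hC x) (abs_nonneg c)

/-- Gambles on `X`. -/
abbrev Gamble : Type _ := gambles X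

variable {X}

/-- The constant gamble with value `r`. -/
def const (r : ℝ) : Gamble X := ⟨fun _ => r, |r|, fun _ => le_rfl⟩

variable (X) in
/-- The positive options: the gambles with strictly positive infimum. -/
def strictlyPositive : Set (Gamble X) := {u | 0 < ⨅ x, u.1 x}

/-- Archimedean sets of desirable gambles. -/
structure IsArchimedean (D : Set (Gamble X)) : Prop extends
    IsCoherent (strictlyPositive X) D where
  archimedean : ∀ u ∈ D, ∃ ε : ℝ, 0 < ε ∧ u - const ε ∈ D

/-- Archimedean sets of desirable sets of gambles. -/
structure IsArchimedeanSets (K : Set (Finset (Gamble X))) : Prop extends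
    IsCoherentSets (strictlyPositive X) K where
  archimedean : ∀ A ∈ K, ∃ ε : ℝ, 0 < ε ∧ shift A (const ε) ∈ K

variable (X) in
/-- The collection of all mixing and Archimedean sets of desirable gambles. -/
def mixingArchimedean : Set (Set (Gamble X)) :=
  {D | IsMixing (strictlyPositive X) D ∧ IsArchimedean D}

/-- The mixing and Archimedean sets of desirable gambles `D` with `K ⊆ K_D`. -/
def mixingArchimedeanAbove (K : Set (Finset (Gamble X))) : Set (Set (Gamble X)) :=
  {D ∈ mixingArchimedean X | K ⊆ setsOf D}

/-- Coherent lower previsions. -/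
structure IsCoherentLowerPrevision (P : Gamble X → ℝ) : Prop where
  inf_le : ∀ u, ⨅ x, u.1 x ≤ P u
  smul : ∀ u, ∀ a : ℝ, 0 < a → P (a • u) = a * P u
  superadditive : ∀ u v, P u + P v ≤ P (u + v)

/-- Linear previsions. -/
structure IsLinearPrevision (P : Gamble X → ℝ) : Prop extends IsCoherentLowerPrevision P where
  additive : ∀ u v, P (u + v) = P u + P v

/-- The lower prevision `u ↦ sup {r : u - r ∈ D}` of a set of desirable gambles. It is only used
for Archimedean `D` (and non-empty `X`), where the supremum is that of a non-empty set of reals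
that is bounded above. -/
def lowerPrevision (D : Set (Gamble X)) (u : Gamble X) : ℝ := sSup {r : ℝ | u - const r ∈ D}

/-- A family of Archimedean sets of desirable gambles is closed when it contains all its limit
points, that is, every Archimedean `D` whose lower prevision belongs to the closure, for the
topology of pointwise convergence on `Gamble X → ℝ`, of the set of lower previsions of the
members of the family. -/
def IsClosedFamily (𝒟 : Set (Set (Gamble X))) : Prop :=
  ∀ D, IsArchimedean D → lowerPrevision D ∈ closure (lowerPrevision '' 𝒟) → D ∈ 𝒟

/-- `𝒟` is a non-empty closed family of mixing and Archimedean sets of desirable gambles such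
that `K` is the intersection of the `K_D`, `D ∈ 𝒟`. -/
structure Represents (𝒟 : Set (Set (Gamble X))) (K : Set (Finset (Gamble X))) : Prop where
  nonempty : 𝒟.Nonempty
  subset : 𝒟 ⊆ mixingArchimedean X
  closed : IsClosedFamily 𝒟
  eq_iInter : K = ⋂ D ∈ 𝒟, setsOf D

end Gambles

end Desirability

end

/-! The maps `P ↦ positiveGambles P` and `D ↦ lowerPrevision D` are mutually inverse between linear
previsions and mixing Archimedean sets of gambles. They match closed families with closed sets of
previsions, and E-admissibility translates directly. So all three conditions say that `K =
setsOfPrevisions M` for a non-empty closed set `M` of linear previsions. Such a `K` is Archimedean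
because `M` is compact (`isArchimedeanSets_setsOfPrevisions`). Conversely, each `A ∉ K` needs a
linear prevision that is nonpositive on `A` and positive somewhere on every member of `K`. The cone
generated by `-A` is not refuted by `K` (`IsMixingSets.not_refutes_hull_neg`); Zorn enlarges it to
an unrefuted cone meeting every member of `K` (`IsCoherentSets.exists_cone_meets_all`). A prevision
nonnegative on that cone exists by Riesz extension, and Archimedeanity upgrades `≥ 0` to `> 0`. -/

namespace Desirability

/-! ### Positive combinations. -/

section PositiveCombinations

variable {V : Type*} [AddCommGroup V] [Module ℝ V]

theorem subset_posi (S : Set V) : S ⊆ posi S := fun x hx =>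
  ⟨1, one_pos, fun _ => 1, fun _ => x, fun _ => one_pos, fun _ => hx, by simp⟩

theorem add_mem_posi {S : Set V} {x y : V} (hx : x ∈ posi S) (hy : y ∈ posi S) :
    x + y ∈ posi S := by
  obtain ⟨n, hn, c, u, hc, hu, rfl⟩ := hx
  obtain ⟨m, -, d, v, hd, hv, rfl⟩ := hy
  refine ⟨n + m, by omega, Fin.append c d, Fin.append u v, fun k => ?_, fun k => ?_, ?_⟩
  · refine Fin.addCases (fun i => ?_) (fun i => ?_) k
    · simpa using hc i
    · simpa using hd i
  · refine Fin.addCases (fun i => ?_) (fun i => ?_) k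
    · simpa using hu i
    · simpa using hv i
  · simp [Fin.sum_univ_add]

theorem smul_mem_posi {S : Set V} {x : V} (hx : x ∈ posi S) {a : ℝ} (ha : 0 < a) :
    a • x ∈ posi S := by
  obtain ⟨n, hn, c, u, hc, hu, rfl⟩ := hx
  exact ⟨n, hn, fun k => a * c k, u, fun k => mul_pos ha (hc k), hu, by
    simp [Finset.smul_sum, smul_smul]⟩

/-- Every element of a finitely generated cone is zero or a positive combination of generators. -/
theorem eq_zero_or_neg_mem_posi {S : Set V} {x : V} (hx : x ∈ PointedCone.hull ℝ (-S)) :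
    x = 0 ∨ -x ∈ posi S := by
  induction hx using Submodule.span_induction with
  | mem x h => exact .inr (subset_posi S h)
  | zero => exact .inl rfl
  | add x y _ _ hx hy =>
    rcases hx with rfl | hx
    · simpa using hy
    rcases hy with rfl | hy
    · simpa using Or.inr hx
    · right
      rw [neg_add]
      exact add_mem_posi hx hy
  | smul a x _ hx =>
    rcases hx with rfl | hx
    · simp
    rcases eq_or_lt_of_le a.2 with ha | ha
    · left
      rw [show a = 0 from Subtype.ext ha.symm, zero_smul]
    · right
      rw [← smul_neg]
      exact smul_mem_posi hx ha

theorem exists_pos_of_mem_posi {S : Set V} (f : V →ₗ[ℝ] ℝ) {x : V} (hx : x ∈ posi S)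
    (h : 0 < f x) : ∃ u ∈ S, 0 < f u := by
  obtain ⟨n, -, c, u, hc, hu, rfl⟩ := hx
  by_contra! hneg
  refine h.not_ge ?_
  rw [map_sum]
  refine Finset.sum_nonpos fun k _ => ?_
  rw [map_smul, smul_eq_mul]
  exact mul_nonpos_of_nonneg_of_nonpos (hc k).le (hneg _ (hu k))

end PositiveCombinations

/-! ### Option sets and E-admissibility. -/

section OptionSets

variable {V : Type*} [AddCommGroup V]

theorem mem_shift {A : Finset V} {v w : V} : w ∈ shift A v ↔ ∃ u ∈ A, u - v = w := by
  classical
  simp [shift]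

open Classical in
theorem exists_mem_erase_zero {A : Finset V} {p : V → Prop} (h0 : ¬ p 0) (h : ∃ u ∈ A, p u) :
    ∃ u ∈ A.erase 0, p u := by
  obtain ⟨u, hu, hp⟩ := h
  refine ⟨u, Finset.mem_erase.2 ⟨?_, hu⟩, hp⟩
  rintro rfl
  exact h0 hp

/-- The option sets that contain an option of positive prevision, for all previsions in `M`. -/
def setsOfPrevisions (M : Set (V → ℝ)) : Set (Finset V) :=
  {A | ∀ P ∈ M, ∃ u ∈ A, 0 < P u}

theorem mem_combine [Module ℝ V] {l m : V → V → ℝ} {A B : Finset V} {u v : V}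
    (hu : u ∈ A) (hv : v ∈ B) :
    l u v • u + m u v • v ∈ combine l m A B := by
  classical
  exact Finset.mem_image₂_of_mem hu hv

/-- By additivity, `u` is rejected iff every `P ∈ M` is positive on some `v - u`; taking `u = 0`
recovers `K` from the rejection function. -/
theorem connected_eRejected_iff {K : Set (Finset V)} {M : Set (V → ℝ)}
    (hM : ∀ P ∈ M, ∀ u v, P (u - v) = P u - P v) :
    Connected K (eRejected M) ↔ K = setsOfPrevisions M := by
  classical
  have key : Connected (setsOfPrevisions M) (eRejected M) := fun u A => by
    have : u ∈ eRejected M (insert u A) ↔ ∀ P ∈ M, ∃ v ∈ A, P u < P v := by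
      simp [eRejected, eAdmissible]
    refine Iff.trans ?_ (this.trans (forall₂_congr fun P hP => ?_))
    · simp
    · simp [mem_shift, hM P hP]
  refine ⟨fun h => ?_, fun h => h ▸ key⟩
  ext A
  simpa [shift] using (h 0 A).symm.trans (key 0 A)

end OptionSets

/-! ### Maximal cones that `K` does not refute. -/

section Separation

variable {V : Type*} [AddCommGroup V] [Module ℝ V] {pos : Set V} {K : Set (Finset V)}

open Classical in
/-- Each member of a desirable option set may be replaced by its combinations with the members of
another desirable option set. -/
theorem IsCoherentSets.exists_subset_of_combinations (hK : IsCoherentSets pos K) {Q : Set V}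
    {A : Finset V} (hA : A ∈ K)
    (h : ∀ a ∈ A, ∃ B ∈ K, ∀ b ∈ B, ∃ l m, PosPair l m ∧ l • a + m • b ∈ Q) :
    ∃ T ∈ K, (T : Set V) ⊆ Q := by
  -- `T` collects the options already in `Q`, `S` those still to be replaced.
  suffices H : ∀ S T : Finset V, (T : Set V) ⊆ Q → T ∪ S ∈ K →
      (∀ a ∈ S, ∃ B ∈ K, ∀ b ∈ B, ∃ l m, PosPair l m ∧ l • a + m • b ∈ Q) →
      ∃ T ∈ K, (T : Set V) ⊆ Q from H A ∅ (by simp) (by simpa using hA) h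
  intro S
  induction S using Finset.induction with
  | empty => exact fun T hTQ hT _ => ⟨T, by simpa using hT, hTQ⟩
  | insert a S _ ih =>
    intro T hTQ hT hS
    obtain ⟨B, hB, hBQ⟩ := hS a (Finset.mem_insert_self a S)
    have hlm : ∀ b, ∃ l m, b ∈ B → PosPair l m ∧ l • a + m • b ∈ Q := fun b => by
      by_cases hb : b ∈ B
      · obtain ⟨l, m, h⟩ := hBQ b hb
        exact ⟨l, m, fun _ => h⟩
      · exact ⟨0, 0, fun h => absurd h hb⟩
    choose l m hlm using hlm
    refine ih (T ∪ B.image fun b => l b • a + m b • b) ?_ ?_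
      fun a' ha' => hS a' (Finset.mem_insert_of_mem ha')
    · intro x hx
      rcases Finset.mem_union.1 hx with hx | hx
      · exact hTQ hx
      · obtain ⟨b, hb, rfl⟩ := Finset.mem_image.1 hx
        exact (hlm b hb).2
    -- The coefficients `(1, 0)` leave every option other than `a` unchanged.
    · refine hK.mono _ (hK.cone _ hT B hB (fun u v => if u = a then l v else 1)
        (fun u v => if u = a then m v else 0) fun u _ v hv => ?_) _ ?_
      · by_cases hu : u = a
        · simpa [hu] using (hlm v hv).1
        · simp [hu, PosPair]
      · intro x hx
        obtain ⟨u, hu, v, hv, rfl⟩ := Finset.mem_image₂.1 hx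
        by_cases hua : u = a
        · subst hua
          simpa using Or.inr (Or.inl ⟨v, hv, rfl⟩)
        · simpa [hua] using (Finset.mem_union.1 hu).imp_right fun h =>
            Or.inr (Finset.mem_of_mem_insert_of_ne h hua)

/-- A desirable option set whose members can all be made negative by adding elements of `S`
refutes the desirability of all elements of `S`. -/
def Refutes (pos : Set V) (K : Set (Finset V)) (S : PointedCone ℝ V) : Prop :=
  ∃ B ∈ K, ∀ b ∈ B, ∃ l : ℝ, 0 ≤ l ∧ ∃ s ∈ S, -(l • b + s) ∈ pos

theorem refutes_of_neg_mem {S : PointedCone ℝ V} (hK : K.Nonempty) {s : V} (hs : s ∈ S)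
    (h : -s ∈ pos) : Refutes pos K S := by
  obtain ⟨A, hA⟩ := hK
  exact ⟨A, hA, fun _ _ => ⟨0, le_rfl, s, hs, by simpa using h⟩⟩

/-- If adjoining any `a ∈ A` led to a refutation, the refuting combinations `l • a + m • b` could
replace the members of `A`, and the resulting option set would refute `S` itself. -/
theorem IsCoherentSets.exists_not_refutes_sup_hull (hK : IsCoherentSets pos K)
    {S : PointedCone ℝ V} (hS : ¬ Refutes pos K S) {A : Finset V} (hA : A ∈ K) :
    ∃ a ∈ A, ¬ Refutes pos K (S ⊔ PointedCone.hull ℝ {a}) := by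
  by_contra! h
  have hS' : ∀ s ∈ S, -s ∉ pos := fun s hs hn => hS (refutes_of_neg_mem ⟨A, hA⟩ hs hn)
  obtain ⟨T, hT, hTQ⟩ := hK.exists_subset_of_combinations (Q := {t | ∃ s ∈ S, -(t + s) ∈ pos})
    hA fun a ha => by
      obtain ⟨B, hB, hBS⟩ := h a ha
      refine ⟨B, hB, fun b hb => ?_⟩
      obtain ⟨m, hm, x, hx, hp⟩ := hBS b hb
      obtain ⟨s, hs, y, hy, rfl⟩ := Submodule.mem_sup.1 hx
      obtain ⟨l, rfl⟩ := Submodule.mem_span_singleton.1 hy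
      have hl : l • a = (l : ℝ) • a := rfl
      refine ⟨l, m, ⟨l.2, hm, ?_⟩, s, hs, ?_⟩
      -- With both coefficients zero, `-s` alone would be positive, so `S` would already be refuted.
      · rcases (add_nonneg l.2 hm).eq_or_lt with h0 | h0
        · have hl0 : (l : ℝ) = 0 := le_antisymm (by linarith) l.2
          have hm0 : m = 0 := le_antisymm (by linarith [l.2]) hm
          rw [hl, hl0, hm0] at hp
          exact absurd (by simpa using hp) (hS' s hs)
        · exact h0
      · convert hp using 2
        rw [hl]
        abel
  exact hS ⟨T, hT, fun t ht => ⟨1, zero_le_one, by simpa using hTQ ht⟩⟩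

/-- If `p = -(l • b + s)` is positive, then `l • b + p = -s` is zero or in `posi A`. Replacing each
`b` this way and erasing zero gives a desirable set inside `posi A`, so mixing would force `A ∈ K`.
-/
theorem IsMixingSets.not_refutes_hull_neg (hK : IsMixingSets pos K) {A : Finset V} (hA : A ∉ K) :
    ¬ Refutes pos K (PointedCone.hull ℝ (-(A : Set V))) := by
  classical
  rintro ⟨B, hB, h⟩
  obtain ⟨T, hT, hTQ⟩ := hK.exists_subset_of_combinations
    (Q := {t | -t ∈ PointedCone.hull ℝ (-(A : Set V))}) hB fun b hb => by
      obtain ⟨l, hl, s, hs, hp⟩ := h b hb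
      refine ⟨_, hK.pos_mem _ hp, fun v hv => ⟨l, 1, ⟨hl, zero_le_one, by linarith⟩, ?_⟩⟩
      rw [Finset.mem_singleton.1 hv]
      simpa using hs
  refine hA (hK.mixing A (A ∪ T.erase 0) (hK.mono _ (hK.erase_zero T hT) _
    Finset.subset_union_right) Finset.subset_union_left fun x hx => ?_)
  rcases Finset.mem_union.1 hx with hx | hx
  · exact subset_posi _ hx
  · obtain ⟨hx0, hxT⟩ := Finset.mem_erase.1 hx
    simpa [hx0] using eq_zero_or_neg_mem_posi (hTQ hxT)

theorem exists_mem_forall_of_isChain {α β : Type*} [Preorder α] {c : Set α}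
    (hc : IsChain (· ≤ ·) c) (hne : c.Nonempty) {q : β → α → Prop}
    (hq : ∀ b, Monotone (q b)) (A : Finset β) (h : ∀ b ∈ A, ∃ S ∈ c, q b S) :
    ∃ S ∈ c, ∀ b ∈ A, q b S := by
  classical
  induction A using Finset.induction with
  | empty => exact hne.imp fun S hS => ⟨hS, by simp⟩
  | insert a A _ ih =>
    obtain ⟨S, hS, hSA⟩ := ih fun b hb => h b (Finset.mem_insert_of_mem hb)
    obtain ⟨S', hS', hSa⟩ := h a (Finset.mem_insert_self a A)
    obtain ⟨T, hT, h1, h2⟩ := hc.directedOn S hS S' hS'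
    refine ⟨T, hT, fun b hb => ?_⟩
    rcases Finset.mem_insert.1 hb with rfl | hb
    · exact hq _ h2 hSa
    · exact hq _ h1 (hSA b hb)

/-- A cone that is not refuted extends to one that meets all desirable option sets. -/
theorem IsCoherentSets.exists_cone_meets_all (hK : IsCoherentSets pos K) {S₀ : PointedCone ℝ V}
    (h₀ : ¬ Refutes pos K S₀) :
    ∃ S, S₀ ≤ S ∧ ¬ Refutes pos K S ∧ ∀ A ∈ K, ∃ a ∈ A, a ∈ S := by
  -- A refutation of the union of a chain involves one finite `B`, hence finitely many cone
  -- elements, all in one member of the chain.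
  obtain ⟨S, h0S, hS⟩ := zorn_le_nonempty₀ {S | ¬ Refutes pos K S} (fun c hcs hc y hy => by
    refine ⟨sSup c, ?_, fun z hz => le_sSup hz⟩
    rintro ⟨B, hB, h⟩
    obtain ⟨S, hS, hSB⟩ := exists_mem_forall_of_isChain hc ⟨y, hy⟩
      (q := fun b S => ∃ l : ℝ, 0 ≤ l ∧ ∃ s ∈ S, -(l • b + s) ∈ pos)
      (by
        rintro b S T hST ⟨l, hl, s, hs, hp⟩
        exact ⟨l, hl, s, hST hs, hp⟩) B
      (by
        intro b hb
        obtain ⟨l, hl, s, hs, hp⟩ := h b hb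
        obtain ⟨S, hS, hsS⟩ := (Submodule.mem_sSup_of_directed ⟨y, hy⟩ hc.directedOn).1 hs
        exact ⟨S, hS, l, hl, s, hsS, hp⟩)
    exact hcs hS ⟨B, hB, hSB⟩) S₀ h₀
  refine ⟨S, h0S, hS.prop, fun A hA => ?_⟩
  obtain ⟨a, ha, h⟩ := hK.exists_not_refutes_sup_hull hS.prop hA
  exact ⟨a, ha, hS.le_of_ge h le_sup_left
    (Submodule.mem_sup_right (Submodule.subset_span rfl))⟩

end Separation

/-! ### Linear previsions and mixing Archimedean sets of gambles. -/

section LinearPrevisions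

variable {X : Type*}

theorem bddBelow_gamble (u : Gamble X) : BddBelow (Set.range u.1) := by
  obtain ⟨C, hC⟩ := u.2
  exact ⟨-C, by rintro _ ⟨x, rfl⟩; exact (abs_le.1 (hC x)).1⟩

theorem const_add (r s : ℝ) : (const (r + s) : Gamble X) = const r + const s := rfl

theorem smul_const (r s : ℝ) : r • (const s : Gamble X) = const (r * s) := rfl

theorem const_zero : (const 0 : Gamble X) = 0 := rfl

/-- The linear map underlying a linear prevision. -/
theorem IsLinearPrevision.exists_linearMap {P : Gamble X → ℝ} (hP : IsLinearPrevision P) :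
    ∃ f : Gamble X →ₗ[ℝ] ℝ, ∀ u, f u = P u := by
  have h0 : P 0 = 0 := by simpa using hP.additive 0 0
  have hneg : ∀ u, P (-u) = -P u := fun u => by
    have := hP.additive u (-u)
    rw [add_neg_cancel, h0] at this
    linarith
  refine ⟨⟨⟨P, hP.additive⟩, fun a u => ?_⟩, fun _ => rfl⟩
  change P (a • u) = a * P u
  rcases lt_trichotomy a 0 with ha | rfl | ha
  · have := hP.smul u (-a) (by linarith)
    rw [neg_smul a u, hneg] at this
    linarith
  · simp [h0]
  · exact hP.smul u a ha

theorem IsLinearPrevision.map_zero {P : Gamble X → ℝ} (hP : IsLinearPrevision P) : P 0 = 0 := by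
  simpa using hP.additive 0 0

theorem IsLinearPrevision.map_neg {P : Gamble X → ℝ} (hP : IsLinearPrevision P) (u) :
    P (-u) = -P u := by
  obtain ⟨f, hf⟩ := hP.exists_linearMap
  simp [← hf]

theorem IsLinearPrevision.map_sub {P : Gamble X → ℝ} (hP : IsLinearPrevision P) (u v) :
    P (u - v) = P u - P v := by
  obtain ⟨f, hf⟩ := hP.exists_linearMap
  simp [← hf]

theorem IsLinearPrevision.pos_of_mem {P : Gamble X → ℝ} (hP : IsLinearPrevision P)
    {u : Gamble X} (h : u ∈ strictlyPositive X) : 0 < P u :=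
  h.trans_le (hP.inf_le u)

theorem isLinearPrevision_of_nonneg (f : Gamble X →ₗ[ℝ] ℝ) (h1 : f (const 1) = 1)
    (h : ∀ u : Gamble X, (∀ x, 0 ≤ u.1 x) → 0 ≤ f u) : IsLinearPrevision f where
  inf_le u := by
    have := h (u - (⨅ x, u.1 x) • const 1) fun x => by
      simpa [const] using ciInf_le (bddBelow_gamble u) x
    rw [_root_.map_sub, _root_.map_smul, h1] at this
    simpa using this
  smul u a _ := by simp
  superadditive u v := by simp
  additive u v := by simp

/-- The gambles with positive prevision. -/
def positiveGambles (P : Gamble X → ℝ) : Set (Gamble X) := {u | 0 < P u}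

theorem IsCoherent.add_mem {D : Set (Gamble X)} (hD : IsCoherent (strictlyPositive X) D)
    {u v : Gamble X} (hu : u ∈ D) (hv : v ∈ D) : u + v ∈ D := by
  simpa using hD.cone u hu v hv 1 1 ⟨zero_le_one, zero_le_one, by norm_num⟩

theorem IsCoherent.smul_mem {D : Set (Gamble X)} (hD : IsCoherent (strictlyPositive X) D)
    {u : Gamble X} (hu : u ∈ D) {a : ℝ} (ha : 0 < a) : a • u ∈ D := by
  simpa using hD.cone u hu u hu a 0 ⟨ha.le, le_rfl, by linarith⟩

theorem biInter_setsOf_positiveGambles (M : Set (Gamble X → ℝ)) :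
    ⋂ D ∈ positiveGambles '' M, setsOf D = setsOfPrevisions M := by
  ext A
  simp only [Set.biInter_image, Set.mem_iInter]
  rfl

theorem Represents.subset_mixingArchimedeanAbove {𝒟 : Set (Set (Gamble X))}
    {K : Set (Finset (Gamble X))} (h : Represents 𝒟 K) : 𝒟 ⊆ mixingArchimedeanAbove K :=
  fun D hD => ⟨h.subset hD, fun A hA => by
  rw [h.eq_iInter] at hA
  exact Set.mem_iInter₂.1 hA D hD⟩

/-- Linear previsions form a compact set in the topology of pointwise convergence. -/
theorem isCompact_linearPrevisions : IsCompact {P : Gamble X → ℝ | IsLinearPrevision P} := by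
  have hclosed : IsClosed {P : Gamble X → ℝ | IsLinearPrevision P} := by
    have : {P : Gamble X → ℝ | IsLinearPrevision P} =
        (⋂ u, {P | ⨅ x, u.1 x ≤ P u}) ∩ ((⋂ u, ⋂ a : ℝ, ⋂ _ : 0 < a, {P | P (a • u) = a * P u}) ∩
          ⋂ u, ⋂ v, {P | P (u + v) = P u + P v}) := by
      ext P
      simp only [Set.mem_ofPred_eq, Set.mem_inter_iff, Set.mem_iInter]
      exact ⟨fun h => ⟨h.inf_le, h.smul, h.additive⟩,
        fun h => ⟨⟨h.1, h.2.1, fun u v => (h.2.2 u v).ge⟩, h.2.2⟩⟩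
    rw [this]
    refine (isClosed_iInter fun u => isClosed_le continuous_const (continuous_apply u)).inter
      (.inter (isClosed_iInter fun u => isClosed_iInter fun a => isClosed_iInter fun _ =>
        isClosed_eq (continuous_apply _) (continuous_const.mul (continuous_apply u)))
      (isClosed_iInter fun u => isClosed_iInter fun v =>
        isClosed_eq (continuous_apply _) ((continuous_apply u).add (continuous_apply v))))
  -- Tychonoff: `P u` lies between `inf u` and `sup u = -inf (-u)`.
  refine (isCompact_univ_pi fun u : Gamble X =>
    isCompact_Icc (a := ⨅ x, u.1 x) (b := -⨅ x, (-u).1 x)).of_isClosed_subset hclosed ?_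
  intro P (hP : IsLinearPrevision P) u _
  have := hP.inf_le (-u)
  rw [hP.map_neg] at this
  exact ⟨hP.inf_le u, by linarith⟩

variable [Nonempty X]

/-- Non-emptiness of `X` matters: a real infimum over an empty type is `0` by default. -/
theorem mem_strictlyPositive {u : Gamble X} :
    u ∈ strictlyPositive X ↔ ∃ δ > 0, ∀ x, δ ≤ u.1 x :=
  ⟨fun h => ⟨_, h, ciInf_le (bddBelow_gamble u)⟩,
    fun ⟨_, hδ, h⟩ => hδ.trans_le (le_ciInf h)⟩

theorem const_mem_strictlyPositive {r : ℝ} (hr : 0 < r) :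
    (const r : Gamble X) ∈ strictlyPositive X :=
  mem_strictlyPositive.2 ⟨r, hr, fun _ => le_rfl⟩

theorem IsLinearPrevision.le_of_forall_le {P : Gamble X → ℝ} (hP : IsLinearPrevision P)
    {u : Gamble X} {r : ℝ} (h : ∀ x, r ≤ u.1 x) : r ≤ P u :=
  (le_ciInf h).trans (hP.inf_le u)

theorem IsLinearPrevision.map_const {P : Gamble X → ℝ} (hP : IsLinearPrevision P) (r : ℝ) :
    P (const r) = r := by
  refine le_antisymm ?_ (hP.le_of_forall_le fun _ => le_rfl)
  have : -r ≤ P (-const r) := hP.le_of_forall_le fun _ => le_rfl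
  rw [hP.map_neg] at this
  linarith

theorem lowerPrevision_positiveGambles {P : Gamble X → ℝ} (hP : IsLinearPrevision P) :
    lowerPrevision (positiveGambles P) = P := by
  ext u
  have : {r : ℝ | u - const r ∈ positiveGambles P} = Set.Iio (P u) := by
    ext r
    simp [positiveGambles, hP.map_sub, hP.map_const]
  rw [lowerPrevision, this, csSup_Iio]

theorem positiveGambles_mem_mixingArchimedean {P : Gamble X → ℝ} (hP : IsLinearPrevision P) :
    positiveGambles P ∈ mixingArchimedean X := by
  have hcoh : IsCoherent (strictlyPositive X) (positiveGambles P) := by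
    refine ⟨by simp [positiveGambles, hP.map_zero], fun u hu => hP.pos_of_mem hu, ?_⟩
    rintro u (hu : 0 < P u) v (hv : 0 < P v) a b ⟨ha, hb, hab⟩
    obtain ⟨f, hf⟩ := hP.exists_linearMap
    change 0 < P _
    rw [← hf] at hu hv ⊢
    simp only [map_add, map_smul, smul_eq_mul]
    rcases ha.eq_or_lt with rfl | ha
    · have : 0 < b := by linarith
      simpa using mul_pos this hv
    · have := mul_pos ha hu
      have := mul_nonneg hb hv.le
      linarith
  refine ⟨⟨hcoh, ?_⟩, hcoh, fun u (hu : 0 < P u) => ⟨P u / 2, by linarith, ?_⟩⟩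
  · rintro A ⟨x, hxA, hx⟩
    obtain ⟨f, hf⟩ := hP.exists_linearMap
    obtain ⟨u, hu, h⟩ := exists_pos_of_mem_posi f hxA (by rw [hf]; exact hx)
    exact ⟨u, hu, by rw [hf] at h; exact h⟩
  · change 0 < P _
    rw [hP.map_sub, hP.map_const]
    linarith

section Archimedean

variable {D : Set (Gamble X)}

/-- The set of admissible `r` is closed downwards by coherence and has no largest element by
Archimedeanity, so it is an open ray. -/
theorem IsArchimedean.mem_sub_const_iff (hD : IsArchimedean D) (u : Gamble X) (r : ℝ) :
    u - const r ∈ D ↔ r < lowerPrevision D u := by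
  obtain ⟨C, hC⟩ := u.2
  have hne : {r : ℝ | u - const r ∈ D}.Nonempty :=
    ⟨-C - 1, hD.pos_subset (mem_strictlyPositive.2 ⟨1, one_pos, fun x => by
      have := (abs_le.1 (hC x)).1
      change 1 ≤ u.1 x - (-C - 1)
      linarith⟩)⟩
  have hbdd : BddAbove {r : ℝ | u - const r ∈ D} := by
    refine ⟨C + 1, fun r (hr : u - const r ∈ D) => ?_⟩
    by_contra! h
    refine hD.zero_notMem ?_
    have : -(u - const r) ∈ D := hD.pos_subset (mem_strictlyPositive.2 ⟨1, one_pos, fun x => by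
      have := (abs_le.1 (hC x)).2
      change 1 ≤ -(u.1 x - r)
      linarith⟩)
    simpa using hD.add_mem hr this
  constructor
  · intro h
    obtain ⟨ε, hε, h'⟩ := hD.archimedean _ h
    rw [sub_sub, ← const_add] at h'
    exact lt_of_lt_of_le (by linarith) (le_csSup hbdd h')
  · intro h
    obtain ⟨s, hs, hrs⟩ := exists_lt_of_lt_csSup hne h
    have := hD.add_mem hs (hD.pos_subset (const_mem_strictlyPositive (sub_pos.2 hrs)))
    rwa [show u - const s + const (s - r) = u - const r by
      rw [show (const s : Gamble X) = const r + const (s - r) by rw [← const_add]; congr 1; ring]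
      abel] at this

theorem IsArchimedean.positiveGambles_lowerPrevision (hD : IsArchimedean D) :
    positiveGambles (lowerPrevision D) = D := by
  ext u
  change 0 < lowerPrevision D u ↔ u ∈ D
  simpa [const_zero] using (hD.mem_sub_const_iff u 0).symm

theorem isLinearPrevision_lowerPrevision (hD : D ∈ mixingArchimedean X) :
    IsLinearPrevision (lowerPrevision D) := by
  obtain ⟨hmix, hD⟩ := hD
  have key := hD.mem_sub_const_iff
  have hinf : ∀ u : Gamble X, ⨅ x, u.1 x ≤ lowerPrevision D u := fun u => by
    refine le_of_forall_lt fun r hr => (key u r).1 (hD.pos_subset (mem_strictlyPositive.2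
      ⟨(⨅ x, u.1 x) - r, sub_pos.2 hr, fun x => ?_⟩))
    exact sub_le_sub_right (ciInf_le (bddBelow_gamble u) x) r
  have hsmul : ∀ (u : Gamble X) (a : ℝ), 0 < a →
      a * lowerPrevision D u ≤ lowerPrevision D (a • u) := fun u a ha => by
    refine le_of_forall_lt fun r hr => (key _ r).1 ?_
    have := hD.smul_mem ((key u (r / a)).2 (by rwa [div_lt_iff₀' ha])) ha
    rwa [smul_sub, smul_const, mul_div_cancel₀ r ha.ne'] at this
  have hadd : ∀ u v : Gamble X,
      lowerPrevision D u + lowerPrevision D v ≤ lowerPrevision D (u + v) :=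
    fun u v => by
      refine le_of_forall_lt fun r hr => (key _ r).1 ?_
      -- The shortfall `lowerPrevision D u + lowerPrevision D v - r` is split equally between `u`
      -- and `v`.
      have h1 := (key u (r - (r + lowerPrevision D v - lowerPrevision D u) / 2)).2 (by linarith)
      have h2 := (key v ((r + lowerPrevision D v - lowerPrevision D u) / 2)).2 (by linarith)
      have := hD.add_mem h1 h2
      rwa [sub_add_sub_comm, ← const_add, sub_add_cancel] at this
  have hsub : ∀ u v : Gamble X,
      lowerPrevision D (u + v) ≤ lowerPrevision D u + lowerPrevision D v :=
    fun u v => by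
      classical
      -- If subadditivity failed, the sum of the two gambles, each shifted by its own lower
      -- prevision, would be in `D`; mixing would put one of them in `D`, but the supremum is not
      -- attained.
      by_contra! h
      have hsum := (key (u + v) (lowerPrevision D u + lowerPrevision D v)).2 h
      rw [const_add, ← sub_add_sub_comm] at hsum
      obtain ⟨w, hw, hwD⟩ := hmix.mixing
        {u - const (lowerPrevision D u), v - const (lowerPrevision D v)}
        ⟨_, add_mem_posi (subset_posi _ (by simp)) (subset_posi _ (by simp)), hsum⟩
      rcases Finset.mem_insert.1 hw with rfl | hw
      · exact lt_irrefl _ ((key _ _).1 hwD)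
      · rw [Finset.mem_singleton.1 hw] at hwD
        exact lt_irrefl _ ((key _ _).1 hwD)
  refine ⟨⟨hinf, fun u a ha => le_antisymm ?_ (hsmul u a ha), hadd⟩,
    fun u v => le_antisymm (hsub u v) (hadd u v)⟩
  have := hsmul (a • u) a⁻¹ (inv_pos.2 ha)
  rwa [smul_smul, inv_mul_cancel₀ ha.ne', one_smul, inv_mul_le_iff₀ ha] at this

end Archimedean

/-- A cone of gambles without elements with negative supremum is dominated by a linear
prevision. -/
theorem exists_linearPrevision_nonneg (S : PointedCone ℝ (Gamble X))
    (hS : ∀ s ∈ S, -s ∉ strictlyPositive X) :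
    ∃ P : Gamble X → ℝ, IsLinearPrevision P ∧ ∀ s ∈ S, 0 ≤ P s := by
  -- Adjoining the nonnegative gambles to `S` makes the extended functional monotone. A negative
  -- constant `r = s + n` in the sum would give `-s ≥ -r > 0`, which `hS` excludes.
  let N : PointedCone ℝ (Gamble X) :=
    { carrier := {u | ∀ x, 0 ≤ u.1 x}
      add_mem' := fun hu hv x => add_nonneg (hu x) (hv x)
      zero_mem' := fun _ => le_rfl
      smul_mem' := fun a _ hu x => mul_nonneg a.2 (hu x) }
  have hone : (const 1 : Gamble X) ≠ 0 := fun h => by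
    obtain ⟨x⟩ := ‹Nonempty X›
    exact one_ne_zero (congrFun (congrArg Subtype.val h) x)
  let f : Gamble X →ₗ.[ℝ] ℝ := LinearPMap.mkSpanSingleton (const 1) 1 hone
  have hf : ∀ (r : ℝ) (h : r • const 1 ∈ f.domain), f ⟨r • const 1, h⟩ = r := fun r h => by
    have := LinearPMap.mkSpanSingleton'_apply (const 1 : Gamble X) (1 : ℝ) (σ := RingHom.id ℝ)
      (fun c hc => by simpa [hone] using hc) r h
    exact this.trans (mul_one r)
  have hmem : ∀ r : ℝ, r • (const 1 : Gamble X) ∈ f.domain := fun r =>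
    Submodule.mem_span_singleton.2 ⟨r, rfl⟩
  obtain ⟨g, hg, hgS⟩ := riesz_extension (S ⊔ N) f (by
    rintro ⟨y, hy⟩ hyS
    obtain ⟨r, rfl⟩ := Submodule.mem_span_singleton.1 hy
    rw [hf]
    obtain ⟨s, hs, n, hn, hsn⟩ := Submodule.mem_sup.1 hyS
    by_contra! hr
    refine hS s hs (mem_strictlyPositive.2 ⟨-r, by linarith, fun x => ?_⟩)
    have h1 : s.1 x + n.1 x = r * 1 := congrFun (congrArg Subtype.val hsn) x
    have h2 := hn x
    change -r ≤ -s.1 x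
    linarith) (fun y => by
    obtain ⟨C, hC⟩ := y.2
    refine ⟨⟨_, hmem C⟩, Submodule.mem_sup_right fun x => ?_⟩
    have := (abs_le.1 (hC x)).1
    change 0 ≤ C * 1 + y.1 x
    linarith)
  refine ⟨g, isLinearPrevision_of_nonneg g ?_ fun u hu => hgS u (Submodule.mem_sup_right hu),
    fun s hs => hgS s (Submodule.mem_sup_left hs)⟩
  have := (hg ⟨_, hmem 1⟩).trans (hf 1 (hmem 1))
  simpa using this

end LinearPrevisions

/-! ### Representation of `K` by its compatible previsions. -/

section Representation

variable {X : Type*} [Nonempty X] {K : Set (Finset (Gamble X))}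

/-- The linear previsions that are positive on some member of each desirable option set. -/
def compatiblePrevisions (K : Set (Finset (Gamble X))) : Set (Gamble X → ℝ) :=
  {P | IsLinearPrevision P ∧ ∀ A ∈ K, ∃ u ∈ A, 0 < P u}

/-- The weak inequality on `A - ε` is a strict one on `A`. -/
theorem IsArchimedeanSets.exists_pos_of_nonneg (hK : IsArchimedeanSets K) {P : Gamble X → ℝ}
    (hP : IsLinearPrevision P) (h : ∀ A ∈ K, ∃ u ∈ A, 0 ≤ P u) :
    ∀ A ∈ K, ∃ u ∈ A, 0 < P u := by
  intro A hA
  obtain ⟨ε, hε, hAε⟩ := hK.archimedean A hA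
  obtain ⟨v, hv, hPv⟩ := h _ hAε
  obtain ⟨u, hu, rfl⟩ := mem_shift.1 hv
  rw [hP.map_sub, hP.map_const] at hPv
  exact ⟨u, hu, by linarith⟩

/-- Archimedeanity allows the strict inequalities to be weakened, and each option set is finite, so
its condition is a finite union of closed half-spaces. -/
theorem isClosed_compatiblePrevisions (hK : IsArchimedeanSets K) :
    IsClosed (compatiblePrevisions K) := by
  have : compatiblePrevisions K =
      {P | IsLinearPrevision P} ∩ ⋂ A ∈ K, ⋃ u ∈ A, {P | 0 ≤ P u} := by
    ext P
    simp only [Set.mem_inter_iff, Set.mem_iInter, Set.mem_iUnion, Set.mem_ofPred_eq, exists_prop]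
    exact ⟨fun h => ⟨h.1, fun A hA => (h.2 A hA).imp fun u hu => ⟨hu.1, hu.2.le⟩⟩,
      fun h => ⟨h.1, hK.exists_pos_of_nonneg h.1 h.2⟩⟩
  rw [this]
  exact isCompact_linearPrevisions.isClosed.inter (isClosed_biInter fun A _ =>
    A.finite_toSet.isClosed_biUnion fun u _ => isClosed_le continuous_const (continuous_apply u))

theorem exists_compatiblePrevision_nonpos (hK : IsMixingSets (strictlyPositive X) K)
    (hKA : IsArchimedeanSets K) {A : Finset (Gamble X)} (hA : A ∉ K) :
    ∃ P ∈ compatiblePrevisions K, ∀ u ∈ A, P u ≤ 0 := by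
  obtain ⟨S, hAS, hS, hSK⟩ := hK.exists_cone_meets_all (hK.not_refutes_hull_neg hA)
  have hne : K.Nonempty := ⟨_, hK.pos_mem _ (const_mem_strictlyPositive one_pos)⟩
  obtain ⟨P, hP, hPS⟩ := exists_linearPrevision_nonneg S
    fun s hs h => hS (refutes_of_neg_mem hne hs h)
  refine ⟨P, ⟨hP, hKA.exists_pos_of_nonneg hP fun B hB =>
    (hSK B hB).imp fun u hu => ⟨hu.1, hPS u hu.2⟩⟩, fun u hu => ?_⟩
  have := hPS (-u) (hAS (Submodule.subset_span (by simpa using hu)))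
  rw [hP.map_neg] at this
  linarith

theorem setsOfPrevisions_compatiblePrevisions (hK : IsMixingSets (strictlyPositive X) K)
    (hKA : IsArchimedeanSets K) : setsOfPrevisions (compatiblePrevisions K) = K := by
  refine Set.Subset.antisymm (fun A hA => ?_) fun A hA P hP => hP.2 A hA
  by_contra h
  obtain ⟨P, hP, hPA⟩ := exists_compatiblePrevision_nonpos hK hKA h
  obtain ⟨u, hu, hPu⟩ := hA P hP
  exact hPu.not_ge (hPA u hu)

theorem compatiblePrevisions_nonempty (hK : IsMixingSets (strictlyPositive X) K)
    (hKA : IsArchimedeanSets K) : (compatiblePrevisions K).Nonempty := by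
  -- `∅ ∉ K`, since otherwise monotonicity would give `{0} ∈ K`.
  obtain ⟨P, hP, -⟩ := exists_compatiblePrevision_nonpos hK hKA (A := ∅)
    fun h => hK.zero_notMem (hK.mono _ h _ (Finset.empty_subset _))
  exact ⟨P, hP⟩

/-! ### From closed sets of previsions to choice models. -/

section SetsOfPrevisions

variable {M : Set (Gamble X → ℝ)}

theorem isMixingSets_setsOfPrevisions (hne : M.Nonempty) (hM : ∀ P ∈ M, IsLinearPrevision P) :
    IsMixingSets (strictlyPositive X) (setsOfPrevisions M) := by
  refine ⟨⟨fun A hA P hP => ?_, fun h => ?_, fun u hu P hP => ?_, ?_, ?_⟩, ?_⟩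
  · exact exists_mem_erase_zero (hM P hP).map_zero.not_gt (hA P hP)
  · obtain ⟨P, hP⟩ := hne
    obtain ⟨u, hu, h⟩ := h P hP
    rw [Finset.mem_singleton.1 hu, (hM P hP).map_zero] at h
    exact lt_irrefl _ h
  · exact ⟨u, Finset.mem_singleton_self u, (hM P hP).pos_of_mem hu⟩
  · intro A₁ h₁ A₂ h₂ l m hlm P hP
    obtain ⟨u, hu, hPu⟩ := h₁ P hP
    obtain ⟨v, hv, hPv⟩ := h₂ P hP
    exact ⟨_, mem_combine hu hv,
      (positiveGambles_mem_mixingArchimedean (hM P hP)).2.cone u hPu v hPv _ _ (hlm u hu v hv)⟩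
  · intro A₁ h₁ A₂ h P hP
    exact (h₁ P hP).imp fun u hu => ⟨h hu.1, hu.2⟩
  · intro A B hB _ hBA P hP
    obtain ⟨u, hu, hPu⟩ := hB P hP
    exact (positiveGambles_mem_mixingArchimedean (hM P hP)).1.mixing A ⟨u, hBA hu, hPu⟩

/-- The maximum of `P u` over `u ∈ A` is continuous in `P`, so it attains a positive minimum on the
compact set `M`; half of that minimum serves as `ε`. -/
theorem isArchimedeanSets_setsOfPrevisions (hne : M.Nonempty) (hM : ∀ P ∈ M, IsLinearPrevision P)
    (hc : IsClosed M) : IsArchimedeanSets (setsOfPrevisions M) := by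
  refine ⟨(isMixingSets_setsOfPrevisions hne hM).toIsCoherentSets, fun A hA => ?_⟩
  have hAne : A.Nonempty := by
    obtain ⟨P, hP⟩ := hne
    exact (hA P hP).imp fun u hu => hu.1
  obtain ⟨P, hP, hmin⟩ := (isCompact_linearPrevisions.of_isClosed_subset hc hM).exists_isMinOn hne
    (f := fun P => A.sup' hAne fun u => P u)
    (Continuous.finset_sup'_apply hAne fun u _ => continuous_apply u).continuousOn
  obtain ⟨u, hu, hPu⟩ := hA P hP
  have hpos : 0 < A.sup' hAne fun u => P u := (Finset.lt_sup'_iff _).2 ⟨u, hu, hPu⟩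
  refine ⟨_, half_pos hpos, fun Q hQ => ?_⟩
  obtain ⟨v, hv, hQv⟩ := (Finset.lt_sup'_iff _).1 ((half_lt_self hpos).trans_le (hmin hQ))
  refine ⟨_, mem_shift.2 ⟨v, hv, rfl⟩, ?_⟩
  rw [(hM Q hQ).map_sub, (hM Q hQ).map_const]
  exact sub_pos.2 hQv

theorem lowerPrevision_image_positiveGambles (hM : ∀ P ∈ M, IsLinearPrevision P) :
    lowerPrevision '' (positiveGambles '' M) = M := by
  rw [Set.image_image, Set.image_congr fun P hP => lowerPrevision_positiveGambles (hM P hP),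
    Set.image_id']

theorem represents_image_positiveGambles (hne : M.Nonempty) (hM : ∀ P ∈ M, IsLinearPrevision P)
    (hc : IsClosed M) : Represents (positiveGambles '' M) (setsOfPrevisions M) where
  nonempty := hne.image _
  subset := by
    rintro _ ⟨P, hP, rfl⟩
    exact positiveGambles_mem_mixingArchimedean (hM P hP)
  closed D hD h := by
    rw [lowerPrevision_image_positiveGambles hM, hc.closure_eq] at h
    exact ⟨_, h, hD.positiveGambles_lowerPrevision⟩
  eq_iInter := (biInter_setsOf_positiveGambles M).symm

end SetsOfPrevisions

/-! ### From families of sets of gambles to sets of previsions. -/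

section Families

variable {𝒟 : Set (Set (Gamble X))}

theorem positiveGambles_image_lowerPrevision (h : 𝒟 ⊆ mixingArchimedean X) :
    positiveGambles '' (lowerPrevision '' 𝒟) = 𝒟 := by
  rw [Set.image_image,
    Set.image_congr fun D hD => (h hD).2.positiveGambles_lowerPrevision, Set.image_id']

theorem Represents.isLinearPrevision (h : Represents 𝒟 K) :
    ∀ P ∈ lowerPrevision '' 𝒟, IsLinearPrevision P := by
  rintro _ ⟨D, hD, rfl⟩
  exact isLinearPrevision_lowerPrevision (h.subset hD)

/-- A limit `P` of the lower previsions is again linear, so it is the lower prevision of the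
Archimedean set `positiveGambles P`, to which closedness of the family applies. -/
theorem Represents.isClosed_image (h : Represents 𝒟 K) : IsClosed (lowerPrevision '' 𝒟) := by
  refine isClosed_of_closure_subset fun P hP => ?_
  have hlin : IsLinearPrevision P :=
    closure_minimal h.isLinearPrevision isCompact_linearPrevisions.isClosed hP
  refine ⟨positiveGambles P, h.closed _ (positiveGambles_mem_mixingArchimedean hlin).2 ?_,
    lowerPrevision_positiveGambles hlin⟩
  rwa [lowerPrevision_positiveGambles hlin]

theorem Represents.eq_setsOfPrevisions (h : Represents 𝒟 K) :
    K = setsOfPrevisions (lowerPrevision '' 𝒟) := by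
  rw [← biInter_setsOf_positiveGambles, positiveGambles_image_lowerPrevision h.subset]
  exact h.eq_iInter

theorem image_positiveGambles_compatiblePrevisions (K : Set (Finset (Gamble X))) :
    positiveGambles '' compatiblePrevisions K = mixingArchimedeanAbove K := by
  refine Set.Subset.antisymm ?_ fun D hD => ⟨lowerPrevision D,
    ⟨isLinearPrevision_lowerPrevision hD.1, fun A hA => ?_⟩,
    hD.1.2.positiveGambles_lowerPrevision⟩
  · rintro _ ⟨P, hP, rfl⟩
    exact ⟨positiveGambles_mem_mixingArchimedean hP.1, fun A hA => hP.2 A hA⟩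
  · obtain ⟨u, hu, huD⟩ := hD.2 hA
    rw [← hD.1.2.positiveGambles_lowerPrevision] at huD
    exact ⟨u, hu, huD⟩

theorem represents_mixingArchimedeanAbove (hK : IsMixingSets (strictlyPositive X) K)
    (hKA : IsArchimedeanSets K) : Represents (mixingArchimedeanAbove K) K := by
  have := represents_image_positiveGambles (compatiblePrevisions_nonempty hK hKA)
    (fun P hP => hP.1) (isClosed_compatiblePrevisions hKA)
  rwa [image_positiveGambles_compatiblePrevisions,
    setsOfPrevisions_compatiblePrevisions hK hKA] at this

end Families

end Representation

end Desirability

theorem mainTheorem5 {X : Type*} [Nonempty X]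
    (K : Set (Finset (Desirability.Gamble X))) :
    -- representation by a non-empty closed family of mixing Archimedean sets of gambles
    ((Desirability.IsMixingSets (Desirability.strictlyPositive X) K ∧
        Desirability.IsArchimedeanSets K) ↔
      ∃ 𝒟 : Set (Set (Desirability.Gamble X)), Desirability.Represents 𝒟 K) ∧
    -- E-admissibility with respect to a non-empty closed set of linear previsions
    ((Desirability.IsMixingSets (Desirability.strictlyPositive X) K ∧
        Desirability.IsArchimedeanSets K) ↔
      ∃ M : Set (Desirability.Gamble X → ℝ), M.Nonempty ∧
        (∀ P ∈ M, Desirability.IsLinearPrevision P) ∧ IsClosed M ∧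
        Desirability.Connected K (Desirability.eRejected M)) ∧
    -- the largest representing family
    ((Desirability.IsMixingSets (Desirability.strictlyPositive X) K ∧
        Desirability.IsArchimedeanSets K) →
      IsGreatest {𝒟 : Set (Set (Desirability.Gamble X)) | Desirability.Represents 𝒟 K}
        (Desirability.mixingArchimedeanAbove K)) := by
  have of_previsions : ∀ M : Set (Desirability.Gamble X → ℝ), M.Nonempty →
      (∀ P ∈ M, Desirability.IsLinearPrevision P) → IsClosed M →
      K = Desirability.setsOfPrevisions M →
      Desirability.IsMixingSets (Desirability.strictlyPositive X) K ∧
        Desirability.IsArchimedeanSets K := by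
    rintro M hne hM hc rfl
    exact ⟨Desirability.isMixingSets_setsOfPrevisions hne hM,
      Desirability.isArchimedeanSets_setsOfPrevisions hne hM hc⟩
  refine ⟨⟨fun h => ⟨_, Desirability.represents_mixingArchimedeanAbove h.1 h.2⟩, ?_⟩,
    ⟨fun h => ?_, ?_⟩, fun h => ⟨Desirability.represents_mixingArchimedeanAbove h.1 h.2,
      fun 𝒟 h𝒟 => h𝒟.subset_mixingArchimedeanAbove⟩⟩
  · rintro ⟨𝒟, h⟩
    exact of_previsions _ (h.nonempty.image _) h.isLinearPrevision h.isClosed_image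
      h.eq_setsOfPrevisions
  · exact ⟨_, Desirability.compatiblePrevisions_nonempty h.1 h.2, fun P hP => hP.1,
      Desirability.isClosed_compatiblePrevisions h.2,
      (Desirability.connected_eRejected_iff fun P hP => hP.1.map_sub).2
        (Desirability.setsOfPrevisions_compatiblePrevisions h.1 h.2).symm⟩
  · rintro ⟨M, hne, hM, hc, h⟩
    exact of_previsions M hne hM hc
      ((Desirability.connected_eRejected_iff fun P hP => (hM P hP).map_sub).1 h)
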